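/- Let $S^1=\mathbb{R}/\mathbb{Z}$, let $Y=S^1\times S^1$ be the torus with its natural orientation and $\pi_1:Y\to S^1$ the first projection, and let $v=(0,1)$ be the unit vector field tangent to the fibres of $\pi_1$. Let $f:Y\to Y$ be a $C^1$ diffeomorphism such that (a) $f$ preserves the orientation of $Y$; (b) $f$ preserves the area of some (continuous) Riemannian metric on $Y$; (c) (twist condition) at each point the vectors $v$ and $df(v)$ are linearly independent, and the basis $(v,df(v))$ has the same orientation (positive or negative) at all points. For a continuous $\phi:S^1\to S^1$, the curve $\Gamma=\{(x,\phi(x)):x\in S^1\}$, oriented by the parametrization $x\mapsto(x,\phi(x))$, is called an invariant rotational circle of $f$ if $f(\Gamma)=\Gamma$ and $f|_\Gamma$ preserves the orientation of $\Gamma$. Its rotation number $\rho(\Gamma)\in\mathbb{R}/\mathbb{Z}$ is that of the orientation-preserving circle homeomorphism $h=(\pi_1|_\Gamma)\circ(f|_\Gamma)\circ(\pi_1|_\Gamma)^{-1}$, namely $\rho(\Gamma)=\lim_{k\to\infty}\frac{g^k(x)-x}{k}\pmod 1$ for any continuous, strictly increasing lift $g:\mathbb{R}\to\mathbb{R}$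 of $h$ with $g(x+1)=g(x)+1$ (neither the existence of the limit nor its value mod $1$ depends on $x$ or $g$). Let $\phi_t:S^1\to S^1$, $t\in[a,b]$, be a family of functions such that $\phi_t(x)$ is continuous as a function of $(t,x)$, such that for each $t$ the function $\phi_t$ defines an invariant rotational circle $\Gamma_t$ of $f$, and such that the circles $\Gamma_t$ are pairwise disjoint. Then there exists a continuous strictly monotone (strictly increasing or strictly decreasing) function $r:[a,b]\to\mathbb{R}$ such that $$\rho(\Gamma_t)=r(t)\pmod 1\qquad\text{for all } t\in[a,b].$$ -/

import Mathlib

/-- The circle `ℝ / ℤ`. -/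
abbrev S1 : Type := UnitAddCircle

/-- The torus `S¹ × S¹`. -/
abbrev Torus : Type := S1 × S1

/-- The natural projection `ℝ² → S¹ × S¹`. -/
def torusProj (p : ℝ × ℝ) : Torus := ((p.1 : S1), (p.2 : S1))

/-! ### Orientation preserving circle homeomorphisms and their rotation number -/

/-- `g` is a continuous strictly increasing lift, with `g (x + 1) = g x + 1`, of the circle
map `h`. -/
structure IsIncreasingLift (g : CircleDeg1Lift) (h : S1 → S1) : Prop where
  continuous : Continuous g
  strictMono : StrictMono g
  lifts : ∀ x : ℝ, ((g x : ℝ) : S1) = h (x : S1)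

/-- `h : S¹ → S¹` is an orientation preserving homeomorphism: it is a homeomorphism and has
a continuous strictly increasing lift commuting with `x ↦ x + 1`. -/
def IsOrientationPreservingCircleHomeo (h : S1 → S1) : Prop :=
  IsHomeomorph h ∧ ∃ g : CircleDeg1Lift, IsIncreasingLift g h

open Classical in
/-- The rotation number `ρ(h) = r(g) mod 1` of an orientation preserving circle homeomorphism
`h`, where `g` is a lift of `h` and `r(g) = lim (gᵏ x - x) / k`
is its translation number. It does not depend on `g`, see `rotationNumber_eq`. (The value is `0`
for maps that have no increasing lift.) -/
noncomputable def rotationNumber (h : S1 → S1) : S1 :=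
  if H : ∃ g : CircleDeg1Lift, IsIncreasingLift g h then
    ((H.choose.translationNumber : ℝ) : S1)
  else 0

theorem rotationNumber_eq {h : S1 → S1} {g : CircleDeg1Lift} (hg : IsIncreasingLift g h) :
    rotationNumber h = ((g.translationNumber : ℝ) : S1) := by
  have H : ∃ g : CircleDeg1Lift, IsIncreasingLift g h := ⟨g, hg⟩
  have hk := H.choose_spec
  rw [rotationNumber, dif_pos H]
  set k := H.choose
  have hint : ∀ x : ℝ, ∃ n : ℤ, (n : ℝ) = k x - g x := by
    intro x
    have h0 : ((k x - g x : ℝ) : S1) = 0 := by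
      rw [AddCircle.coe_sub, hk.lifts, hg.lifts, sub_self]
    obtain ⟨n, hn⟩ := (AddCircle.coe_eq_zero_iff (1 : ℝ)).1 h0
    exact ⟨n, by simpa using hn⟩
  choose n hn using hint
  have hnc : Continuous n := by
    rw [Int.isClosedEmbedding_coe_real.isEmbedding.continuous_iff]
    have : (Int.cast ∘ n : ℝ → ℝ) = fun x => k x - g x := funext hn
    rw [this]
    exact hk.continuous.sub hg.continuous
  have hconst : ∀ x, n x = n 0 := fun x =>
    PreconnectedSpace.constant inferInstance hnc
  have hkg : ∀ x, k x = g x + n 0 := fun x => by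
    have := hn x
    rw [hconst x] at this
    linarith
  have hpow : ∀ m : ℕ, (k ^ m) 0 = (g ^ m) 0 + m * (n 0 : ℝ) := by
    intro m
    induction m with
    | zero => simp
    | succ m ih =>
      rw [pow_succ', pow_succ', CircleDeg1Lift.mul_apply, CircleDeg1Lift.mul_apply, ih, hkg]
      have : g ((g ^ m) 0 + m * (n 0 : ℝ)) = g ((g ^ m) 0) + m * (n 0 : ℝ) := by
        have := g.map_add_int ((g ^ m) 0) (m * n 0)
        push_cast at this
        exact this
      rw [this]
      push_cast
      ring
  have hτ : k.translationNumber = g.translationNumber + n 0 := by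
    refine k.translationNumber_eq_of_tendsto₀' ?_
    have h1 := g.tendsto_translation_number₀'.add_const (n 0 : ℝ)
    refine h1.congr fun m => ?_
    rw [← CircleDeg1Lift.coe_pow, hpow (m + 1)]
    have : (m : ℝ) + 1 ≠ 0 := by positivity
    push_cast
    field_simp
  rw [hτ, AddCircle.coe_add]
  have : ((n 0 : ℝ) : S1) = 0 :=
    (AddCircle.coe_eq_zero_iff (1 : ℝ)).2 ⟨n 0, by simp⟩
  rw [this, add_zero]

/-! ### Diffeomorphisms of the torus -/

/-- `F : ℝ² → ℝ²` is a `C¹` lift of the torus map `f`. -/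
structure IsC1Lift (F : ℝ × ℝ → ℝ × ℝ) (f : Torus → Torus) : Prop where
  contDiff : ContDiff ℝ 1 F
  lifts : ∀ p, torusProj (F p) = f (torusProj p)

/-- `f` is a `C¹` diffeomorphism of the torus: `f` and its inverse are `C¹`. -/
def IsC1Diffeo (f : Torus ≃ Torus) : Prop :=
  (∃ F, IsC1Lift F f) ∧ (∃ G, IsC1Lift G f.symm)

/-- `f` preserves the orientation of the torus. (Any two lifts of `f` differ by
a constant, so that the derivative does not depend on the lift.) -/
def PreservesTorusOrientation (f : Torus → Torus) : Prop :=
  ∃ F, IsC1Lift F f ∧ ∀ p, 0 < (fderiv ℝ F p).det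

/-- The determinant of the pair `(u, w)` of plane vectors: it is nonzero iff `u, w` are linearly
independent, and its sign is the orientation of the basis `(u, w)`. -/
def pairDet (u w : ℝ × ℝ) : ℝ := u.1 * w.2 - u.2 * w.1

/-- The twist condition. With `v = (0, 1)` the unit vector field tangent to the fibres of the
first projection, `v` and `df(v)` are linearly independent at each point, and the basis
`(v, df(v))` has the same orientation (either one) at all points. -/
def IsTwist (f : Torus → Torus) : Prop :=
  ∃ F, IsC1Lift F f ∧
    ((∀ p, 0 < pairDet (0, 1) (fderiv ℝ F p (0, 1))) ∨
      (∀ p, pairDet (0, 1) (fderiv ℝ F p (0, 1)) < 0))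

/-- A (continuous) Riemannian metric `E dx² + 2 F dx dy + G dy²` on the torus. -/
structure TorusMetric where
  E : Torus → ℝ
  F : Torus → ℝ
  G : Torus → ℝ
  continuous_E : Continuous E
  continuous_F : Continuous F
  continuous_G : Continuous G
  E_pos : ∀ p, 0 < E p
  disc_pos : ∀ p, 0 < E p * G p - F p ^ 2

/-- The Riemannian area measure `√(E G - F²) dx dy`. -/
noncomputable def TorusMetric.area (m : TorusMetric) : MeasureTheory.Measure Torus :=
  MeasureTheory.volume.withDensity
    (fun p => ENNReal.ofReal (Real.sqrt (m.E p * m.G p - m.F p ^ 2)))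

/-- `f` preserves the area of some Riemannian metric on the torus. -/
def PreservesSomeRiemannianArea (f : Torus → Torus) : Prop :=
  ∃ m : TorusMetric, MeasureTheory.MeasurePreserving f m.area m.area

/-! ### Invariant rotational circles -/

/-- The curve `Γ = {(x, φ x)}` in the torus defined by `φ : S¹ → S¹`. -/
def circleGraph (φ : S1 → S1) : Set Torus := Set.range fun x => (x, φ x)

/-- The restriction `f|Γ` to the graph `Γ` of `φ`, read on `S¹` through `π₁|Γ : Γ → S¹`, i.e.
`(π₁|Γ) ∘ (f|Γ) ∘ (π₁|Γ)⁻¹`. -/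
def inducedCircleMap (f : Torus → Torus) (φ : S1 → S1) : S1 → S1 := fun x => (f (x, φ x)).1

/-- `φ` defines an invariant rotational circle `Γ` of `f`: `φ` is continuous, `f(Γ) = Γ` and
`f|Γ` preserves the orientation of `Γ`, which is oriented by its parametrization
`x ↦ (x, φ x)`. -/
structure IsInvariantRotationalCircle (f : Torus → Torus) (φ : S1 → S1) : Prop where
  continuous : Continuous φ
  invariant : f '' circleGraph φ = circleGraph φ
  orientation : IsOrientationPreservingCircleHomeo (inducedCircleMap f φ)

/-- The rotation number `ρ(Γ) = ρ(f|Γ)` of the invariant rotational circle defined by `φ`. -/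
noncomputable def circleRotationNumber (f : Torus → Torus) (φ : S1 → S1) : S1 :=
  rotationNumber (inducedCircleMap f φ)

/-! Disjointness makes the lifts `Φ t x` strictly monotone in `t`, with one direction for all `x`,
and the twist carries this over to the lifts `g t` of the circle maps. So the translation number is
monotone and continuous in `t`; the issue is strictness. Suppose it is constant on `[s, t]`. A
near-return of an orbit of an intermediate lift, squeezed between strictly ordered neighbours,
forces the constant to be rational, `m / n` (`exists_translationNumber_pow_eq_int`). Then `f^[n]`
has fixed points on every circle in between, so each of its recurrent points there is fixed
(`eq_add_int_of_recurrent`). By Poincaré recurrence and Fubini, some vertical fibre consists almost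
entirely of recurrent points, so it meets two of these circles in fixed points. But `(g w ^ n) x` is
strictly increasing in `w`, so it equals `x + m` at most once. -/

open Filter Topology MeasureTheory Function

/-! ### Translation numbers and recurrence on the circle. -/

namespace CircleDeg1Lift

/-- The translation number depends continuously on a parameter. -/
theorem continuous_translationNumber_of_continuous {I : Type*} [TopologicalSpace I]
    {g : I → CircleDeg1Lift} (hg : Continuous fun p : I × ℝ => g p.1 p.2) :
    Continuous fun t => (g t).translationNumber := by
  have hpow : ∀ n : ℕ, Continuous fun t => (g t ^ n) 0 := by
    intro n
    induction n with
    | zero => simpa using continuous_const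
    | succ n ih =>
      simp only [pow_succ', mul_apply]
      exact hg.comp (continuous_id.prodMk ih)
  -- The error of `(g ^ n) 0` against `n` times the translation number is at most 1 for every lift,
  -- so convergence is uniform in `t`.
  have hlim : TendstoUniformly (fun (n : ℕ) t => (g t ^ (n + 1)) 0 / ((n : ℝ) + 1))
      (fun t => (g t).translationNumber) atTop := by
    rw [Metric.tendstoUniformly_iff]
    intro ε hε
    have h0 := tendsto_one_div_add_atTop_nhds_zero_nat (𝕜 := ℝ)
    filter_upwards [h0.eventually (gt_mem_nhds hε)] with n hn t
    refine lt_of_le_of_lt ?_ hn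
    have hd := (g t).dist_pow_map_zero_mul_translationNumber_le (n + 1)
    have hpos : (0 : ℝ) < n + 1 := by positivity
    rw [Real.dist_eq] at hd ⊢
    push_cast at hd
    have : (g t).translationNumber - (g t ^ (n + 1)) 0 / ((n : ℝ) + 1)
        = -(((g t ^ (n + 1)) 0 - ((n : ℝ) + 1) * (g t).translationNumber) / (n + 1)) := by
      field_simp
      ring
    rw [this, abs_neg, abs_div, abs_of_pos hpos]
    gcongr
  exact hlim.continuous (Frequently.of_forall fun n => (hpow _).div_const _)

/-- Some orbit of a circle map returns arbitrarily close to its starting point. -/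
theorem exists_abs_pow_sub_lt (g : CircleDeg1Lift) {ε : ℝ} (hε : 0 < ε) :
    ∃ (x : ℝ) (n : ℕ) (m : ℤ), 0 < n ∧ |(g ^ n) x - (x + m)| < ε := by
  obtain ⟨c, -, θ, hθ, hc⟩ := isCompact_univ.tendsto_subseq
    (x := fun n : ℕ => (((g ^ n) 0 : ℝ) : UnitAddCircle)) fun _ => Set.mem_univ _
  obtain ⟨N, hN⟩ := Metric.cauchySeq_iff.1 hc.cauchySeq ε hε
  have h := hN (N + 1) (by omega) N le_rfl
  have hlt : θ N < θ (N + 1) := hθ (by omega)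
  simp only [comp_apply] at h
  rw [dist_eq_norm, ← AddCircle.coe_sub, UnitAddCircle.norm_eq] at h
  refine ⟨(g ^ θ N) 0, θ (N + 1) - θ N, round ((g ^ θ (N + 1)) 0 - (g ^ θ N) 0), by omega, ?_⟩
  rw [← mul_apply, ← pow_add, Nat.sub_add_cancel hlt.le, ← sub_sub]
  exact h

/-- A pointwise inequality between continuous lifts is uniform. -/
theorem exists_forall_add_le {f g : CircleDeg1Lift} (hf : Continuous f) (hg : Continuous g)
    (h : ∀ x, f x < g x) : ∃ ε > 0, ∀ x, f x + ε ≤ g x := by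
  obtain ⟨x₀, -, hx₀⟩ := isCompact_Icc.exists_isMinOn (Set.nonempty_Icc.2 zero_le_one)
    (hg.sub hf).continuousOn (s := Set.Icc (0 : ℝ) 1)
  refine ⟨g x₀ - f x₀, sub_pos.2 (h x₀), fun x => ?_⟩
  have hx := hx₀ (a := Int.fract x) ⟨Int.fract_nonneg x, (Int.fract_lt_one x).le⟩
  simp only [Set.mem_ofPred_eq, Pi.sub_apply, Int.fract, map_sub_int] at hx
  linarith

/-- If two strictly ordered lifts have the same translation number as a lift strictly between
them, then this translation number is rational. -/
theorem exists_translationNumber_pow_eq_int {f g k : CircleDeg1Lift} (hf : Continuous f)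
    (hg : Continuous g) (hk : Continuous k) (hfg : ∀ x, f x < g x) (hgk : ∀ x, g x < k x)
    (h₁ : f.translationNumber = g.translationNumber)
    (h₂ : k.translationNumber = g.translationNumber) :
    ∃ (n : ℕ) (m : ℤ), 0 < n ∧ n * g.translationNumber = m := by
  obtain ⟨ε₁, hε₁, hfg'⟩ := exists_forall_add_le hf hg hfg
  obtain ⟨ε₂, hε₂, hgk'⟩ := exists_forall_add_le hg hk hgk
  obtain ⟨x, n, m, hn, hx⟩ := g.exists_abs_pow_sub_lt (lt_min hε₁ hε₂)
  refine ⟨n, m, hn, ?_⟩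
  obtain ⟨j, rfl⟩ : ∃ j, n = j + 1 := ⟨n - 1, by omega⟩
  have hlt := abs_lt.1 hx
  -- Only the last of the `n` applications needs the gap; it absorbs the return error and puts `(f ^
  -- n) x` below `x + m`.
  have hfp : (f ^ (j + 1)) x + ε₁ ≤ (g ^ (j + 1)) x := by
    rw [pow_succ', pow_succ', mul_apply, mul_apply]
    refine le_trans (add_le_add_left (f.monotone ?_) _) (hfg' _)
    exact pow_mono (fun y => (hfg y).le) j x
  have hkp : (g ^ (j + 1)) x + ε₂ ≤ (k ^ (j + 1)) x := by
    rw [pow_succ', pow_succ', mul_apply, mul_apply]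
    refine le_trans (hgk' _) (k.monotone ?_)
    exact pow_mono (fun y => (hgk y).le) j x
  apply le_antisymm
  · rw [← h₁, ← translationNumber_pow]
    apply translationNumber_le_of_le_add_int (x := x)
    linarith [min_le_left ε₁ ε₂, hlt.2]
  · rw [← h₂, ← translationNumber_pow]
    apply le_translationNumber_of_add_int_le (x := x)
    linarith [min_le_right ε₁ ε₂, hlt.1]

/-- A recurrent point of a circle map with a fixed point is fixed. -/
theorem eq_add_int_of_recurrent {g : CircleDeg1Lift} {m : ℤ}
    {c : ℝ} (hc : g c = c + m) {x : ℝ}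
    (hx : ∀ s ∈ 𝓝 (x : UnitAddCircle), ∃ᶠ n in atTop, (((g ^ n) x : ℝ) : UnitAddCircle) ∈ s) :
    g x = x + m := by
  by_contra hne
  set G : ℝ → ℝ := fun y => g y - m with hG
  have hGm : Monotone G := fun y z h => sub_le_sub_right (g.monotone h) _
  have hGadd : ∀ (y : ℝ) (k : ℤ), G (y + k) = G y + k := fun y k => by
    simp only [hG, map_add_int]; ring
  have hGc : ∀ k : ℤ, G (c + k) = c + k := fun k => by
    rw [hGadd]; simp only [hG, hc]; ring
  have hGpow : ∀ n : ℕ, (((g ^ n) x : ℝ) : UnitAddCircle) = ((G^[n] x : ℝ) : UnitAddCircle) := by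
    have : ∀ n : ℕ, (g ^ n) x = G^[n] x + ((n * m : ℤ) : ℝ) := by
      intro n
      induction n with
      | zero => simp
      | succ n ih =>
        rw [pow_succ', mul_apply, ih, iterate_succ_apply', map_add_int]
        simp only [hG]
        push_cast
        ring
    intro n
    rw [this, AddCircle.coe_add]
    have h0 : (((n * m : ℤ) : ℝ) : UnitAddCircle) = 0 :=
      (AddCircle.coe_eq_zero_iff (1 : ℝ)).2 ⟨n * m, by simp⟩
    rw [h0, add_zero]
  -- An orbit confined to a compact interval free of lifts of `x` stays away from `x` on the circle.
  have key : ∀ u w : ℝ, (∀ y ∈ Set.Icc u w, ∀ k : ℤ, y ≠ x + k) →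
      (∀ n : ℕ, G^[n + 1] x ∈ Set.Icc u w) → False := by
    intro u w huw hn
    set K : Set UnitAddCircle := (fun y : ℝ => (y : UnitAddCircle)) '' Set.Icc u w
    have hK : IsClosed K := (isCompact_Icc.image (AddCircle.continuous_mk' 1)).isClosed
    have hxK : (x : UnitAddCircle) ∉ K := by
      rintro ⟨y, hy, hyx⟩
      have : ((y - x : ℝ) : UnitAddCircle) = 0 := by
        rw [AddCircle.coe_sub]; exact sub_eq_zero.2 hyx
      obtain ⟨k, hk⟩ := (AddCircle.coe_eq_zero_iff (1 : ℝ)).1 this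
      refine huw y hy k ?_
      simp at hk
      linarith
    obtain ⟨n, hn1, hnK⟩ := ((hx _ (hK.isOpen_compl.mem_nhds hxK)).and_eventually
      (eventually_ge_atTop 1)).exists.imp fun _ h => h.symm
    obtain ⟨j, rfl⟩ : ∃ j, n = j + 1 := ⟨n - 1, by omega⟩
    exact hnK ⟨_, hn j, (hGpow _).symm⟩
  -- Now `c + k - 1` and `c + k` are consecutive translates of `c`, fixed by `G`, that trap the
  -- monotone orbit of `x`.
  set k : ℤ := ⌈x - c⌉ with hkdef
  have hup : x ≤ c + k := by linarith [Int.le_ceil (x - c)]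
  have hlo : c + k < x + 1 := by linarith [Int.ceil_lt_add_one (x - c)]
  have hxk : x ≠ c + k := by
    intro h
    apply hne
    have := hGc k
    rw [← h] at this
    simp only [hG] at this
    linarith
  have hupper : ∀ n, G^[n] x ≤ c + k := fun n => by
    induction n with
    | zero => exact hup
    | succ n ih => rw [iterate_succ_apply', ← hGc k]; exact hGm ih
  have hlower : ∀ n, c + k - 1 ≤ G^[n] x := fun n => by
    have hc1 := hGc (k - 1)
    push_cast at hc1
    induction n with
    | zero => simp only [iterate_zero, id_eq]; linarith
    | succ n ih =>
      rw [iterate_succ_apply']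
      calc c + k - 1 = G (c + (k - 1)) := by rw [hc1]; ring
        _ ≤ _ := hGm (by linarith)
  have hGx : G x ≠ x := fun h => hne (by simp only [hG] at h; linarith)
  have habsurd : ∀ y : ℝ, ∀ j : ℤ, y = x + j → x - 1 < y → y < x + 1 → y ≠ x → False := by
    rintro _ j rfl h1 h2 h3
    have h1' : (-1 : ℤ) < j := by
      have : ((-1 : ℤ) : ℝ) < j := by push_cast; linarith
      exact_mod_cast this
    have h2' : j < 1 := by
      have : (j : ℝ) < ((1 : ℤ) : ℝ) := by push_cast; linarith
      exact_mod_cast this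
    have : j = 0 := by omega
    simp [this] at h3
  have hltk : x < c + k := lt_of_le_of_ne hup hxk
  rcases lt_or_gt_of_ne hGx with h | h
  · have hle : ∀ n, G^[n + 1] x ≤ G x := fun n => by
      have := hGm.antitone_iterate_of_map_le h.le (show 1 ≤ n + 1 by omega) 
      simpa using this
    refine key (c + k - 1) (G x) (fun y hy j hj => ?_) fun n => ⟨hlower _, hle n⟩
    exact habsurd y j hj (by linarith [hy.1]) (by linarith [hy.2]) (ne_of_lt (by linarith [hy.2]))
  · have hle : ∀ n, G x ≤ G^[n + 1] x := fun n => by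
      have := hGm.monotone_iterate_of_le_map h.le (show 1 ≤ n + 1 by omega)
      simpa using this
    refine key (G x) (c + k) (fun y hy j hj => ?_) fun n => ⟨hle n, hupper _⟩
    exact habsurd y j hj (by linarith [hy.1]) (by linarith [hy.2]) (ne_of_gt (by linarith [hy.1]))

end CircleDeg1Lift

/-! ### Recurrence on the torus, lifts, and the twist. -/

/-- Poincaré recurrence for the area, which is finite by compactness. Its density is positive, so
area-null sets are Lebesgue-null. -/
theorem PreservesSomeRiemannianArea.ae_recurrent {f : Torus → Torus}
    (h : PreservesSomeRiemannianArea f) (n : ℕ) :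
    ∀ᵐ z : Torus, ∀ s ∈ 𝓝 z, ∃ᶠ k in atTop, (f^[n])^[k] z ∈ s := by
  obtain ⟨m, hm⟩ := h
  set d : Torus → ℝ := fun p => Real.sqrt (m.E p * m.G p - m.F p ^ 2) with hd
  have hdc : Continuous d :=
    ((m.continuous_E.mul m.continuous_G).sub (m.continuous_F.pow 2)).sqrt
  have hfin : IsFiniteMeasure m.area :=
    isFiniteMeasure_withDensity_ofReal
      (hdc.integrable_of_hasCompactSupport (HasCompactSupport.of_compactSpace d)).2
  have hac : (volume : Measure Torus) ≪ m.area := by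
    refine withDensity_absolutelyContinuous' hdc.measurable.ennreal_ofReal.aemeasurable
      (Eventually.of_forall fun p => ?_)
    simpa using m.disc_pos p
  exact hac.ae_le (hm.conservative.iterate n).ae_frequently_mem_of_mem_nhds

/-- A continuous family of functions on the circle has a continuous lift. -/
theorem exists_continuous_lift_of_family {a b : ℝ} (hab : a ≤ b) {φ : Set.Icc a b → S1 → S1}
    (hφ : Continuous fun p : Set.Icc a b × S1 => φ p.1 p.2) :
    ∃ Φ : Set.Icc a b → ℝ → ℝ, (Continuous fun p : Set.Icc a b × ℝ => Φ p.1 p.2) ∧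
      ∀ t x, ((Φ t x : ℝ) : S1) = φ t (x : S1) := by
  -- Extending the family constantly beyond `[a, b]` gives a map on the simply connected plane,
  -- which lifts.
  have hc : Continuous fun p : ℝ × ℝ => φ (Set.projIcc a b hab p.1) (p.2 : S1) :=
    hφ.comp (((continuous_projIcc (h := hab)).comp continuous_fst).prodMk
      ((AddCircle.continuous_mk' 1).comp continuous_snd))
  obtain ⟨e₀, he₀⟩ := QuotientAddGroup.mk_surjective (φ (Set.projIcc a b hab 0) ((0 : ℝ) : S1))
  obtain ⟨Φ, ⟨-, hΦ⟩, -⟩ := (AddCircle.isCoveringMap_coe (1 : ℝ)).existsUnique_continuousMap_lifts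
    ⟨_, hc⟩ ((0, 0) : ℝ × ℝ) e₀ he₀
  refine ⟨fun t x => Φ (t, x), Φ.continuous.comp (continuous_subtype_val.prodMap continuous_id),
    fun t x => ?_⟩
  have := congrFun hΦ ((t : ℝ), x)
  simpa using this

/-- Any continuous lift of an orientation preserving circle homeomorphism is an increasing
lift of degree one. -/
theorem IsOrientationPreservingCircleHomeo.exists_isIncreasingLift {h : S1 → S1}
    (hh : IsOrientationPreservingCircleHomeo h) {G : ℝ → ℝ} (hG : Continuous G)
    (hGh : ∀ x : ℝ, ((G x : ℝ) : S1) = h x) :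
    ∃ g : CircleDeg1Lift, IsIncreasingLift g h ∧ ∀ x, g x = G x := by
  obtain ⟨-, k, hk⟩ := hh
  have hint : ∀ x : ℝ, ∃ n : ℤ, (n : ℝ) = G x - k x := by
    intro x
    have h0 : ((G x - k x : ℝ) : S1) = 0 := by
      rw [AddCircle.coe_sub, hk.lifts, hGh, sub_self]
    obtain ⟨n, hn⟩ := (AddCircle.coe_eq_zero_iff (1 : ℝ)).1 h0
    exact ⟨n, by simpa using hn⟩
  choose n hn using hint
  have hnc : Continuous n := by
    rw [Int.isClosedEmbedding_coe_real.isEmbedding.continuous_iff]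
    have : (Int.cast ∘ n : ℝ → ℝ) = fun x => G x - k x := funext hn
    rw [this]
    exact hG.sub hk.continuous
  have hGk : ∀ x, G x = k x + n 0 := fun x => by
    have hx := hn x
    rw [show n x = n 0 from PreconnectedSpace.constant inferInstance hnc] at hx
    linarith
  have hmono : StrictMono G := fun x y hxy => by
    rw [hGk, hGk]
    exact add_lt_add_left (hk.strictMono hxy) _
  exact ⟨⟨⟨G, hmono.monotone⟩, fun x => by
    simp only [hGk, k.map_add_one]; ring⟩, ⟨hG, hmono, hGh⟩, fun _ => rfl⟩

/-- The twist condition integrated along the fibres. -/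
theorem IsTwist.exists_strictMono_or_strictAnti {f : Torus → Torus} (h : IsTwist f) :
    ∃ F, IsC1Lift F f ∧ ((∀ x, StrictMono fun y => (F (x, y)).1) ∨
      ∀ x, StrictAnti fun y => (F (x, y)).1) := by
  obtain ⟨F, hF, htw⟩ := h
  have hderiv : ∀ x y : ℝ, HasDerivAt (fun y => (F (x, y)).1)
      (-pairDet (0, 1) (fderiv ℝ F (x, y) (0, 1))) y := by
    intro x y
    have h1 : HasFDerivAt F (fderiv ℝ F (x, y)) (x, y) :=
      (hF.contDiff.differentiable one_ne_zero (x, y)).hasFDerivAt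
    have h2 : HasDerivAt (fun y : ℝ => (x, y)) ((0 : ℝ), (1 : ℝ)) y :=
      (hasDerivAt_const y x).prodMk (hasDerivAt_id y)
    have h3 := (hasFDerivAt_fst (𝕜 := ℝ) (p := F (x, y))).comp_hasDerivAt y
      (h1.comp_hasDerivAt y h2)
    have h4 : -pairDet (0, 1) (fderiv ℝ F (x, y) (0, 1)) = (fderiv ℝ F (x, y) (0, 1)).1 := by
      simp [pairDet]
    rw [h4]
    exact h3
  -- The determinant is minus the fibre derivative, so the two cases swap.
  refine ⟨F, hF, htw.symm.imp (fun hp x => strictMono_of_deriv_pos fun y => ?_)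
    fun hp x => strictAnti_of_deriv_neg fun y => ?_⟩
  · rw [(hderiv x y).deriv]; linarith [hp (x, y)]
  · rw [(hderiv x y).deriv]; linarith [hp (x, y)]

/-! ### Strict monotonicity. -/

/-- If the lifts of the induced circle maps of a family of invariant circles of a recurrent map
increase strictly with the parameter, then so do the translation numbers. -/
theorem translationNumber_ne_of_recurrent {I : Type*} [LinearOrder I] [DenselyOrdered I]
    [TopologicalSpace I] (hI : ∀ s t : I, IsPreconnected (Set.Icc s t)) {f : Torus → Torus}
    (hf : ∀ n : ℕ, ∀ᵐ z : Torus, ∀ s ∈ 𝓝 z, ∃ᶠ k in atTop, (f^[n])^[k] z ∈ s)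
    {φ : I → S1 → S1} {Φ : I → ℝ → ℝ} {g : I → CircleDeg1Lift}
    (hΦ : ∀ x, Continuous fun t => Φ t x) (hΦinj : ∀ x, Injective fun t => Φ t x)
    (hΦφ : ∀ t (x : ℝ), ((Φ t x : ℝ) : S1) = φ t x)
    (hg : ∀ t, Continuous (g t))
    (hfg : ∀ t (x : ℝ), f (x, φ t x) = (((g t x : ℝ) : S1), φ t (g t x : ℝ)))
    (hgt : ∀ x, StrictMono fun t => g t x) {s t : I} (hst : s < t) :
    (g s).translationNumber ≠ (g t).translationNumber := by
  intro heq
  have hτ : ∀ w ∈ Set.Icc s t, (g w).translationNumber = (g s).translationNumber := by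
    intro w hw
    apply le_antisymm
    · rw [heq]
      exact CircleDeg1Lift.translationNumber_mono fun x => (hgt x).monotone hw.2
    · exact CircleDeg1Lift.translationNumber_mono fun x => (hgt x).monotone hw.1
  -- The gap between `u` and `v` keeps the two fixed points found below on different circles.
  obtain ⟨u, hsu, hut⟩ := exists_between hst
  obtain ⟨v, huv, hvt⟩ := exists_between hut
  obtain ⟨n, m, hn, hnm⟩ := CircleDeg1Lift.exists_translationNumber_pow_eq_int (hg s) (hg u) (hg t)
    (fun x => hgt x hsu) (fun x => hgt x hut) (hτ u ⟨hsu.le, hut.le⟩).symm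
    (by rw [hτ u ⟨hsu.le, hut.le⟩, heq])
  rw [hτ u ⟨hsu.le, hut.le⟩] at hnm
  have hfpow : ∀ w (k : ℕ) (x : ℝ), f^[k] (x, φ w x) =
      ((((g w ^ k) x : ℝ) : S1), φ w ((g w ^ k) x : ℝ)) := by
    intro w k x
    induction k with
    | zero => simp
    | succ k ih => rw [iterate_succ_apply', ih, hfg, pow_succ', CircleDeg1Lift.mul_apply]
  have hfix : ∀ w ∈ Set.Icc s t, ∀ x : ℝ,
      (∀ U ∈ 𝓝 ((x : S1), φ w x), ∃ᶠ k in atTop, (f^[n])^[k] ((x : S1), φ w x) ∈ U) →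
      (g w ^ n) x = x + m := by
    intro w hw x hrec
    obtain ⟨c, hc⟩ := ((g w ^ n).translationNumber_eq_int_iff
      ((g w).continuous_pow (hg w) n) (m := m)).1
      (by rw [CircleDeg1Lift.translationNumber_pow, hτ w hw, hnm])
    refine CircleDeg1Lift.eq_add_int_of_recurrent hc fun U hU => ?_
    refine (hrec (Prod.fst ⁻¹' U) (continuous_fst.continuousAt hU)).mono fun k hk => ?_
    rwa [← iterate_mul, hfpow, pow_mul] at hk
  obtain ⟨X, hX⟩ := (Measure.ae_ae_of_ae_prod (hf n)).exists
  obtain ⟨x, rfl⟩ := QuotientAddGroup.mk_surjective X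
  have hinj : ∀ w w', w < w' → (g w ^ n) x < (g w' ^ n) x := by
    intro w w' hww
    obtain ⟨j, rfl⟩ : ∃ j, n = j + 1 := ⟨n - 1, by omega⟩
    rw [pow_succ', pow_succ', CircleDeg1Lift.mul_apply, CircleDeg1Lift.mul_apply]
    exact ((g w).monotone (CircleDeg1Lift.pow_mono (fun y => (hgt y).monotone hww.le) j x)).trans_lt
      (hgt _ hww)
  have hmeet : ∀ w w', w < w' → w ∈ Set.Icc s t → w' ∈ Set.Icc s t →
      ∃ z ∈ Set.Icc w w', (g z ^ n) x = x + m := by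
    intro w w' hww hw hw'
    -- The fibre segment between the two circles has positive measure, hence a recurrent point; by
    -- connectedness it lies on some circle of the family.
    have hopen : IsOpen ((fun y : ℝ => (y : S1)) ''
        Set.Ioo (min (Φ w x) (Φ w' x)) (max (Φ w x) (Φ w' x))) :=
      QuotientAddGroup.isOpenMap_coe _ isOpen_Ioo
    obtain ⟨_, ⟨y, hy, rfl⟩, hyrec⟩ := ((frequently_ae_mem_iff.2 (hopen.measure_ne_zero volume
      ((Set.nonempty_Ioo.2 (min_lt_max.2 ((hΦinj x).ne hww.ne))).image _))).and_eventually hX).exists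
    obtain ⟨z, hz, hzy⟩ : ∃ z ∈ Set.Icc w w', Φ z x = y := by
      have h1 : Set.OrdConnected ((fun z => Φ z x) '' Set.Icc w w') :=
        ((hI w w').image _ (hΦ x).continuousOn).ordConnected
      exact h1.uIcc_subset ⟨w, ⟨le_rfl, hww.le⟩, rfl⟩ ⟨w', ⟨hww.le, le_rfl⟩, rfl⟩
        ⟨hy.1.le, hy.2.le⟩
    refine ⟨z, hz, hfix z ⟨hw.1.trans hz.1, hz.2.trans hw'.2⟩ x ?_⟩
    rw [← hΦφ, hzy]
    exact hyrec
  obtain ⟨z, hz, hz'⟩ := hmeet s u hsu ⟨le_rfl, hst.le⟩ ⟨hsu.le, hut.le⟩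
  obtain ⟨w, hw, hw'⟩ := hmeet v t hvt ⟨(hsu.trans huv).le, hvt.le⟩ ⟨hst.le, le_rfl⟩
  have := hinj z w (hz.2.trans_lt (huv.trans_le hw.1))
  linarith

theorem corollary9 (f : Torus ≃ Torus) (hf : IsC1Diffeo f)
    (hor : PreservesTorusOrientation f) (harea : PreservesSomeRiemannianArea f)
    (htwist : IsTwist f) (a b : ℝ) (φ : Set.Icc a b → S1 → S1)
    (hφ : Continuous fun p : Set.Icc a b × S1 => φ p.1 p.2)
    (hcircle : ∀ t, IsInvariantRotationalCircle f (φ t))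
    (hdisj : ∀ s t, s ≠ t → Disjoint (circleGraph (φ s)) (circleGraph (φ t))) :
    ∃ r : Set.Icc a b → ℝ, Continuous r ∧ (StrictMono r ∨ StrictAnti r) ∧
      ∀ t, circleRotationNumber f (φ t) = ((r t : ℝ) : S1) := by
  rcases lt_or_ge b a with hba | hab
  · have : IsEmpty (Set.Icc a b) := Set.isEmpty_coe_sort.2 (Set.Icc_eq_empty hba.not_ge)
    exact ⟨fun _ => 0, continuous_const, .inl fun s => isEmptyElim s, fun t => isEmptyElim t⟩
  have : Inhabited (Set.Icc a b) := ⟨⟨a, le_rfl, hab⟩⟩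
  have hIcc : ∀ s t : Set.Icc a b, IsPreconnected (Set.Icc s t) := by
    intro s t
    rw [← IsInducing.subtypeVal.isPreconnected_image, Set.image_subtype_val_Icc]
    exact isPreconnected_Icc
  have hIccDual : ∀ s t : (Set.Icc a b)ᵒᵈ, IsPreconnected (Set.Icc s t) := by
    intro s t
    rw [← OrderDual.toDual_ofDual s, ← OrderDual.toDual_ofDual t, Set.Icc_toDual]
    exact hIcc (OrderDual.ofDual t) (OrderDual.ofDual s)
  obtain ⟨Φ, hΦc, hΦφ⟩ := exists_continuous_lift_of_family hab hφ
  have hΦt : ∀ x, Continuous fun t => Φ t x := fun x =>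
    hΦc.comp (continuous_id.prodMk continuous_const)
  have hφne : ∀ s t, s ≠ t → ∀ x, φ s x ≠ φ t x := fun s t hst x h =>
    Set.disjoint_left.1 (hdisj s t hst) ⟨x, rfl⟩ ⟨x, by simp only [h]⟩
  have hΦx : ∀ t, Continuous (Φ t) := fun t =>
    hΦc.comp (continuous_const.prodMk continuous_id)
  have hΦinj : ∀ x, Injective fun t => Φ t x := fun x s t h => by
    by_contra hst
    exact hφne s t hst x (by rw [← hΦφ, ← hΦφ]; exact congrArg _ h)
  have hΦmono : (∀ x, StrictMono fun t => Φ t x) ∨ ∀ x, StrictAnti fun t => Φ t x := by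
    have hx := fun x => (hΦt x).strictMono_of_inj (hΦinj x)
    rcases hab.eq_or_lt with rfl | hlt
    · have : Subsingleton (Set.Icc a a) := by simp
      exact .inl fun x => Subsingleton.strictMono _
    set s : Set.Icc a b := ⟨a, le_rfl, hab⟩
    set t : Set.Icc a b := ⟨b, hab, le_rfl⟩
    have hst : s < t := hlt
    -- If the direction depended on `x`, then `Φ t - Φ s` would vanish somewhere and two circles
    -- would meet.
    by_contra! hcon
    obtain ⟨⟨x, hx₁⟩, y, hy₁⟩ := hcon
    have hxst : Φ t x - Φ s x ≤ 0 := sub_nonpos.2 (((hx x).resolve_left hx₁) hst).le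
    have hyst : 0 ≤ Φ t y - Φ s y := sub_nonneg.2 (((hx y).resolve_right hy₁) hst).le
    obtain ⟨z, hz⟩ := mem_range_of_exists_le_of_exists_ge ((hΦx t).sub (hΦx s)) ⟨x, hxst⟩ ⟨y, hyst⟩
    exact hst.ne' (hΦinj z (sub_eq_zero.1 hz))
  obtain ⟨F, hF, hFmono⟩ := htwist.exists_strictMono_or_strictAnti
  have hgex : ∀ t, ∃ g : CircleDeg1Lift, IsIncreasingLift g (inducedCircleMap f (φ t)) ∧
      ∀ x, g x = (F (x, Φ t x)).1 := by
    intro t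
    refine (hcircle t).orientation.exists_isIncreasingLift ?_ fun x => ?_
    · exact (hF.contDiff.continuous.comp (continuous_id.prodMk (hΦx t))).fst
    · have := congrArg Prod.fst (hF.lifts (x, Φ t x))
      simp only [torusProj, hΦφ] at this
      exact this
  choose g hg hgF using hgex
  have hgc : Continuous fun p : Set.Icc a b × ℝ => g p.1 p.2 := by
    simp only [hgF]
    exact (hF.contDiff.continuous.comp (continuous_snd.prodMk hΦc)).fst
  have hgt : (∀ x, StrictMono fun t => g t x) ∨ ∀ x, StrictAnti fun t => g t x := by
    simp only [hgF]
    rcases hFmono with h1 | h1 <;> rcases hΦmono with h2 | h2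
    · exact .inl fun x => (h1 x).comp (h2 x)
    · exact .inr fun x => (h1 x).comp_strictAnti (h2 x)
    · exact .inr fun x => (h1 x).comp_strictMono (h2 x)
    · exact .inl fun x => (h1 x).comp (h2 x)
  have hfg : ∀ t (x : ℝ), f (x, φ t x) = (((g t x : ℝ) : S1), φ t (g t x : ℝ)) := by
    intro t x
    have hmem : f (x, φ t x) ∈ circleGraph (φ t) := by
      rw [← (hcircle t).invariant]
      exact Set.mem_image_of_mem _ ⟨x, rfl⟩
    obtain ⟨y, hy⟩ := hmem
    have : ((g t x : ℝ) : S1) = y := by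
      rw [(hg t).lifts, inducedCircleMap, ← hy]
    rw [this]
    exact hy.symm
  have hcont : Continuous fun t => (g t).translationNumber :=
    CircleDeg1Lift.continuous_translationNumber_of_continuous hgc
  have hrec := harea.ae_recurrent
  have hinj : Injective fun t => (g t).translationNumber := by
    have hne : ∀ s t, s < t → (g s).translationNumber ≠ (g t).translationNumber := by
      intro s t hst
      rcases hgt with h | h
      · exact translationNumber_ne_of_recurrent hIcc hrec hΦt hΦinj hΦφ (fun t => (hg t).continuous)
          hfg h hst
      -- Reversing the order of the parameter turns the decreasing case into the increasing one.
      · exact (translationNumber_ne_of_recurrent (I := (Set.Icc a b)ᵒᵈ) hIccDual hrec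
          hΦt hΦinj hΦφ (fun t => (hg t).continuous) hfg (fun x => (h x).dual_left)
          (OrderDual.toDual_lt_toDual.2 hst)).symm
    intro s t h
    rcases lt_trichotomy s t with hst | hst | hst
    · exact absurd h (hne s t hst)
    · exact hst
    · exact absurd h.symm (hne t s hst)
  exact ⟨_, hcont, hcont.strictMono_of_inj hinj, fun t => rotationNumber_eq (hg t)⟩
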